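/- Let $d$ and $n$ be integers with $d\ge 2$, $n\equiv -1\pmod d$ and $n\ge 2d-1$. For an indeterminate $q$ and an integer $k\ge 0$ write $(x;q)_k=\prod_{j=0}^{k-1}(1-xq^j)$ and $(x,y;q)_k=(x;q)_k(y;q)_k$, let $[n]=1+q+\cdots+q^{n-1}$, and let $(x)_k=x(x+1)\cdots(x+k-1)$ (with $(x)_0=1$). Then $$\frac{(q^d;q^d)_{n-1}^d}{(1-q)^{dn-d}}\sum_{k=0}^{n-1}\frac{(q^{d+1};q^d)_k^{d-2}\,(q,q^{1-d};q^d)_k\,q^{dk}}{(q^d;q^d)_k^d}\equiv 0\pmod{[n]^2},$$ that is, the left-hand side is a polynomial in $q$ with integer coefficients, and it is divisible by $[n]^2$ in $\mathbb{Z}[q]$. Moreover (the case $q\to1$, conjectured by Wang, Li and Tang), $$\frac{(n-1)!^d\,d^{dn-d}}{n^2}\sum_{k=0}^{n-1}\frac{\left(\frac{d+1}{d}\right)_k^{d-2}\left(\frac1d\right)_k\left(\frac{1-d}{d}\right)_k}{(1)_k^d}\in\mathbb{Z}.$$ -/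

import Mathlib

open Polynomial

/-- The `q`-shifted factorial `(x; q)_n = (1 - x) (1 - x q) ⋯ (1 - x q ^ (n - 1))`, for `n ≥ 0`. -/
def qShiftedFactorial {R : Type*} [CommRing R] (x q : R) (n : ℕ) : R :=
  ∏ j ∈ Finset.range n, (1 - x * q ^ j)

/-- The `q`-integer `[n] = 1 + q + ⋯ + q ^ (n - 1)`, as a polynomial in `q` with integer coefficients. -/
noncomputable def qInteger (n : ℕ) : ℤ[X] :=
  ∑ j ∈ Finset.range n, X ^ j

/-- The rational function
`(q^d; q^d)_{n-1}^d / (1-q)^{dn-d} *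
  ∑_{k=0}^{n-1} (q^{d+1}; q^d)_k^{d-2} (q; q^d)_k (q^{1-d}; q^d)_k q^{dk} / (q^d; q^d)_k^d`
in the indeterminate `q`, an element of the fraction field of `ℤ[q]`
(for `d ≥ 2` and `n ≥ 1`, so that the subtractions `d - 2`, `n - 1`, `d * n - d` are the usual ones;
the exponent `1 - d` is an integer). -/
noncomputable def normalizedSum (d n : ℕ) : RatFunc ℤ :=
  let q : RatFunc ℤ := RatFunc.X
  qShiftedFactorial (q ^ d) (q ^ d) (n - 1) ^ d / (1 - q) ^ (d * n - d) *
    ∑ k ∈ Finset.range n,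
      qShiftedFactorial (q ^ (d + 1)) (q ^ d) k ^ (d - 2) *
          (qShiftedFactorial q (q ^ d) k *
            qShiftedFactorial (q ^ (1 - (d : ℤ))) (q ^ d) k) * q ^ (d * k) /
        qShiftedFactorial (q ^ d) (q ^ d) k ^ d

/-!
Distributing the prefactor over the sum writes the left-hand side as a sum of polynomials with integer
coefficients (`normalizedSum_eq_algebraMap`). Its value at `q = 1` is the rational number of the second
part multiplied by `n ^ 2` (`cast_eval_one_normalizedTerm`), so the integrality assertion follows from
the divisibility by `[n] ^ 2`.

As `[n]` is the product of the cyclotomic polynomials `Φ_m` over the divisors `m > 1` of `n`, and these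
are pairwise coprime over `ℚ`, it suffices to divide by each `Φ_m ^ 2`. For `m < n` every single
summand is divisible (`cyclotomic_sq_dvd_normalizedTerm_of_lt`). The substance is the case `m = n`,
where one computes in `ℚ[q] / (Φ_n ^ 2)`, with `q^n = 1 + δ` and `δ ^ 2 = 0`.

Write `d r = n + 1`. If some of the parameters of the sum are multiplied by suitable powers of `q^n`,
one numerator parameter becomes a nonpositive power of `q^d`, which makes the sum terminate, and each
other numerator parameter becomes a denominator parameter times a nonnegative power of `q^d`. Such a
sum vanishes identically, by a `q`-analogue of the Karlsson–Minton summation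
(`sum_karlsson_minton_eq_zero`): apart from the terminating factor, its summand is a polynomial in
`q^(d k)` of degree less than the order of termination. Modulo `δ ^ 2` the summand is affine in the
exponents of the powers of `q^n`, and the undeformed summand is a linear combination of three deformed
ones whose sums vanish (`sum_eq_zero_of_pow_eq_one_add`).
-/

/-! ### A terminating basic hypergeometric summation -/

section QSeries

variable {R : Type*} [CommRing R]

theorem qShiftedFactorial_add (x q : R) (m k : ℕ) :
    qShiftedFactorial x q (m + k) =
      qShiftedFactorial x q m * qShiftedFactorial (x * q ^ m) q k := by
  simp only [qShiftedFactorial, Finset.prod_range_add, pow_add, mul_assoc]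

theorem qShiftedFactorial_succ (x q : R) (k : ℕ) :
    qShiftedFactorial x q (k + 1) = qShiftedFactorial x q k * (1 - x * q ^ k) := by
  simp only [qShiftedFactorial, Finset.prod_range_succ]

theorem qShiftedFactorial_succ' (x q : R) (k : ℕ) :
    qShiftedFactorial x q (k + 1) = (1 - x) * qShiftedFactorial (x * q) q k := by
  rw [add_comm, qShiftedFactorial_add]
  simp [qShiftedFactorial]

/-- The partial sums `∑_{k ≤ M} (c; q)_k q^k / (q; q)_k = (c q; q)_M / (q; q)_M`, multiplied by
`(q; q)_M` so that they hold in any commutative ring: `(q^(k+1); q)_(M-k)` is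
`(q; q)_M / (q; q)_k`. -/
theorem sum_qShiftedFactorial_mul_pow (c q : R) (M : ℕ) :
    ∑ k ∈ Finset.range (M + 1),
      qShiftedFactorial c q k * qShiftedFactorial (q ^ (k + 1)) q (M - k) * q ^ k =
    qShiftedFactorial (c * q) q M := by
  induction M with
  | zero => simp [qShiftedFactorial]
  | succ M ih =>
    rw [Finset.sum_range_succ]
    have h : ∀ k ∈ Finset.range (M + 1),
        qShiftedFactorial c q k * qShiftedFactorial (q ^ (k + 1)) q (M + 1 - k) * q ^ k =
        (1 - q ^ (M + 1)) *
          (qShiftedFactorial c q k * qShiftedFactorial (q ^ (k + 1)) q (M - k) * q ^ k) := by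
      intro k hk
      have hk : k ≤ M := Nat.lt_succ_iff.mp (Finset.mem_range.mp hk)
      rw [Nat.succ_sub hk, qShiftedFactorial_succ, ← pow_add,
        show k + 1 + (M - k) = M + 1 by omega]
      ring
    rw [Finset.sum_congr rfl h, ← Finset.mul_sum, ih, qShiftedFactorial_succ' c,
      qShiftedFactorial_succ (c * q)]
    simp only [Nat.sub_self, qShiftedFactorial, Finset.prod_range_zero]
    ring

/-- If `c = q^(-N)` and `p` has degree less than `N`, then
`∑_k (c; q)_k / (q; q)_k q^k p(q^k) = 0`. The constant `p(1)` contributes a multiple of the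
factor `1 - c q^N` of `(c q; q)_M`. The rest, `p(x) - p(1) = (1 - x) h(x)`, cancels the last factor
of `(q; q)_k`, which leaves a sum of the same shape for `c q`, `N - 1` and `h(q x)`. -/
theorem sum_qShiftedFactorial_mul_eval_eq_zero (q : R) (N : ℕ) :
    ∀ (c : R) (M : ℕ) (p : R[X]), c * q ^ N = 1 → N ≤ M → p.natDegree < N →
    ∑ k ∈ Finset.range (M + 1),
      qShiftedFactorial c q k * qShiftedFactorial (q ^ (k + 1)) q (M - k) * q ^ k *
        p.eval (q ^ k) = 0 := by
  have hconst : ∀ (N : ℕ) (c : R) (M : ℕ) (a : R), c * q ^ (N + 1) = 1 → N + 1 ≤ M →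
      ∑ k ∈ Finset.range (M + 1),
        qShiftedFactorial c q k * qShiftedFactorial (q ^ (k + 1)) q (M - k) * q ^ k * a = 0 := by
    intro N c M a hc hM
    rw [← Finset.sum_mul, sum_qShiftedFactorial_mul_pow, qShiftedFactorial,
      Finset.prod_eq_zero (Finset.mem_range.mpr (show N < M by omega)), zero_mul]
    rw [mul_assoc, ← pow_succ', hc, sub_self]
  induction N with
  | zero => intro c M p _ _ h; omega
  | succ N ih =>
    intro c M p hc hM hp
    nontriviality R
    obtain ⟨M, rfl⟩ : ∃ M', M = M' + 1 := ⟨M - 1, by omega⟩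
    have hdecomp := modByMonic_add_div p (X - C (1 : R))
    rw [modByMonic_X_sub_C_eq_C_eval] at hdecomp
    have hdeg := natDegree_divByMonic p (monic_X_sub_C (1 : R))
    rw [natDegree_X_sub_C] at hdeg
    set g := p /ₘ (X - C (1 : R))
    have heval : ∀ x, p.eval x = p.eval 1 + (1 - x) * (-g).eval x := by
      intro x
      conv_lhs => rw [← hdecomp]
      simp only [eval_add, eval_C, eval_mul, eval_sub, eval_X, eval_neg]
      ring
    have hrest : ∑ k ∈ Finset.range (M + 1 + 1),
        qShiftedFactorial c q k * qShiftedFactorial (q ^ (k + 1)) q (M + 1 - k) * q ^ k *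
          ((1 - q ^ k) * (-g).eval (q ^ k)) = 0 := by
      rcases Nat.eq_zero_or_pos p.natDegree with h0 | hpos
      · have hg : g = 0 := by
          have hpc := eq_C_of_natDegree_eq_zero h0
          refine (divByMonic_eq_zero_iff (monic_X_sub_C (1 : R))).mpr ?_
          rw [degree_X_sub_C, hpc]
          exact lt_of_le_of_lt degree_C_le (by norm_num)
        simp [hg]
      have hih := ih (c * q) M ((-g).comp (C q * X)) (by rw [mul_assoc, ← pow_succ', hc])
        (by omega) (lt_of_le_of_lt natDegree_comp_le (by
          rw [natDegree_neg]
          calc g.natDegree * (C q * X).natDegree ≤ g.natDegree * 1 :=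
                Nat.mul_le_mul_left _ ((natDegree_C_mul_le q X).trans natDegree_X_le)
            _ < N := by omega))
      rw [Finset.sum_range_succ']
      simp only [pow_zero, sub_self, zero_mul, mul_zero, add_zero]
      rw [← mul_zero ((1 - c) * q * (1 - q ^ (M + 1))), ← hih, Finset.mul_sum]
      refine Finset.sum_congr rfl fun k hk => ?_
      have hk : k ≤ M := Nat.lt_succ_iff.mp (Finset.mem_range.mp hk)
      have h1 : (1 - q ^ (k + 1)) * qShiftedFactorial (q ^ (k + 1 + 1)) q (M - k) =
          qShiftedFactorial (q ^ (k + 1)) q (M - k) * (1 - q ^ (M + 1)) := by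
        rw [pow_succ q (k + 1), ← qShiftedFactorial_succ', qShiftedFactorial_succ, ← pow_add,
          show k + 1 + (M - k) = M + 1 by omega]
      rw [show M + 1 - (k + 1) = M - k by omega, qShiftedFactorial_succ']
      simp only [eval_comp, eval_mul, eval_C, eval_X, ← pow_succ']
      linear_combination (1 - c) * qShiftedFactorial (c * q) q k * q ^ (k + 1) *
        eval (q ^ (k + 1)) (-g) * h1
    rw [Finset.sum_congr rfl fun k _ => by rw [heval (q ^ k), mul_add], Finset.sum_add_distrib,
      hconst N c (M + 1) _ hc hM, hrest, add_zero]

/-- The denominator-free form of `(b q^m; q)_k / (b; q)_k = (b q^k; q)_m / (b; q)_m`, which exhibits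
the left-hand side as a polynomial of degree `m` in `q^k`. -/
theorem qShiftedFactorial_exchange (b q : R) (m k l : ℕ) :
    qShiftedFactorial b q m *
        (qShiftedFactorial (b * q ^ m) q k * qShiftedFactorial (b * q ^ k) q l) =
      qShiftedFactorial b q (k + l) * qShiftedFactorial (b * q ^ k) q m := by
  rw [← mul_assoc, ← qShiftedFactorial_add, add_comm m k, qShiftedFactorial_add b q k m,
    qShiftedFactorial_add b q k l]
  ring

/-- A `q`-analogue of the Karlsson–Minton summation: if `c = q^(-N)` and `s m₁ + m₂ < N`, then
`∑_k (c; q)_k / (q; q)_k * ((b₁ q^m₁; q)_k / (b₁; q)_k)^s * (b₂ q^m₂; q)_k / (b₂; q)_k * q^k = 0`,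
multiplied by the denominators of the summand `k = M`. -/
theorem sum_karlsson_minton_eq_zero (q c b₁ b₂ : R) (N M s m₁ m₂ : ℕ) (hc : c * q ^ N = 1)
    (hM : N ≤ M) (hdeg : s * m₁ + m₂ < N)
    (h₁ : IsUnit (qShiftedFactorial b₁ q m₁)) (h₂ : IsUnit (qShiftedFactorial b₂ q m₂)) :
    ∑ k ∈ Finset.range (M + 1),
      qShiftedFactorial c q k * qShiftedFactorial (q ^ (k + 1)) q (M - k) * q ^ k *
        ((qShiftedFactorial (b₁ * q ^ m₁) q k * qShiftedFactorial (b₁ * q ^ k) q (M - k)) ^ s *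
          (qShiftedFactorial (b₂ * q ^ m₂) q k *
            qShiftedFactorial (b₂ * q ^ k) q (M - k))) = 0 := by
  let P : R → ℕ → R[X] := fun b m => ∏ j ∈ Finset.range m, (1 - C (b * q ^ j) * X)
  have hP : ∀ b m k, (P b m).eval (q ^ k) = qShiftedFactorial (b * q ^ k) q m := by
    intro b m k
    simp only [P, eval_prod, qShiftedFactorial, eval_sub, eval_one, eval_mul, eval_C, eval_X]
    exact Finset.prod_congr rfl fun j _ => by ring
  have hPdeg : ∀ b m, (P b m).natDegree ≤ m := by
    intro b m
    refine (natDegree_prod_le _ _).trans ((Finset.sum_le_card_nsmul _ _ 1 fun j _ => ?_).trans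
      (by simp))
    exact (natDegree_sub_le _ _).trans (max_le (by simp) ((natDegree_C_mul_le _ X).trans natDegree_X_le))
  have hzero := sum_qShiftedFactorial_mul_eval_eq_zero q N c M (P b₁ m₁ ^ s * P b₂ m₂) hc hM
    (lt_of_le_of_lt (natDegree_mul_le.trans (add_le_add (natDegree_pow_le.trans
      (Nat.mul_le_mul_left s (hPdeg b₁ m₁))) (hPdeg b₂ m₂))) hdeg)
  refine ((h₁.pow s).mul h₂).mul_right_eq_zero.mp ?_
  rw [Finset.mul_sum, ← mul_zero (qShiftedFactorial b₁ q M ^ s * qShiftedFactorial b₂ q M),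
    ← hzero, Finset.mul_sum]
  refine Finset.sum_congr rfl fun k hk => ?_
  have hk : k ≤ M := Nat.lt_succ_iff.mp (Finset.mem_range.mp hk)
  have e₁ := qShiftedFactorial_exchange b₁ q m₁ k (M - k)
  have e₂ := qShiftedFactorial_exchange b₂ q m₂ k (M - k)
  rw [show k + (M - k) = M by omega] at e₁ e₂
  simp only [eval_mul, eval_pow, hP]
  have e₁s := congrArg (· ^ s) e₁
  simp only [mul_pow] at e₁s ⊢
  linear_combination (qShiftedFactorial c q k * qShiftedFactorial (q ^ (k + 1)) q (M - k) * q ^ k) *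
    (e₁s * (qShiftedFactorial b₂ q m₂ *
        (qShiftedFactorial (b₂ * q ^ m₂) q k * qShiftedFactorial (b₂ * q ^ k) q (M - k))) +
      qShiftedFactorial b₁ q M ^ s * qShiftedFactorial (b₁ * q ^ k) q m₁ ^ s * e₂)

end QSeries

/-! ### The sum modulo the square of a cyclotomic polynomial -/

section FirstOrder

variable {R : Type*} [CommRing R]

theorem add_mul_pow_of_sq_eq_zero {δ : R} (hδ : δ ^ 2 = 0) (a b : R) (k : ℕ) :
    (a + δ * b) ^ k = a ^ k + k * a ^ (k - 1) * (δ * b) := by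
  have h := eval_add_of_sq_eq_zero (X ^ k : R[X]) a (δ * b) (by rw [mul_pow, hδ, zero_mul])
  simpa [derivative_X_pow] using h

/-- For `δ ^ 2 = 0`, the expression `(u (1 + δ e); q)_k` is affine in `e`. -/
theorem exists_qShiftedFactorial_first_order {δ : R} (hδ : δ ^ 2 = 0) (u q : R) (k : ℕ) :
    ∃ v, ∀ e : R, qShiftedFactorial (u * (1 + δ * e)) q k =
      qShiftedFactorial u q k + δ * e * v := by
  let P : R[X] := ∏ j ∈ Finset.range k, (1 - X * C (q ^ j))
  have hP : ∀ x, P.eval x = qShiftedFactorial x q k := by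
    intro x
    simp [P, eval_prod, qShiftedFactorial]
  refine ⟨P.derivative.eval u * u, fun e => ?_⟩
  rw [← hP, ← hP, show u * (1 + δ * e) = u + δ * (u * e) by ring,
    eval_add_of_sq_eq_zero P u (δ * (u * e)) (by rw [mul_pow, hδ, zero_mul])]
  ring

/-- The sum vanishes to first order at a primitive `n`-th root of unity. Here `d = s + 2`,
`n = M + 1`, `r = t + 2` with `d r = n + 1`; the element `p` is `q⁻¹`, so that `p ^ (s + 1)` stands for
`q^(1-d)`; and `q^n = 1 + δ` with `δ ^ 2 = 0`. The sum is a combination of three deformations of it by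
powers of `q^n`, each of which is annihilated by `sum_karlsson_minton_eq_zero`. -/
theorem sum_eq_zero_of_pow_eq_one_add {q p δ : R} {s t M : ℕ} (hqp : q * p = 1)
    (hM : (s + 2) * (t + 2) = M + 2) (hq : q ^ (M + 1) = 1 + δ) (hδ : δ ^ 2 = 0)
    (hunit : ∀ j, ¬ (M + 1) ∣ j → IsUnit (1 - q ^ j)) :
    ∑ k ∈ Finset.range (M + 1),
      qShiftedFactorial (q ^ (s + 3)) (q ^ (s + 2)) k ^ s *
        (qShiftedFactorial q (q ^ (s + 2)) k *
          qShiftedFactorial (p ^ (s + 1)) (q ^ (s + 2)) k) * (q ^ (s + 2)) ^ k *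
        qShiftedFactorial ((q ^ (s + 2)) ^ (k + 1)) (q ^ (s + 2)) (M - k) ^ (s + 2) = 0 := by
  have hqu : IsUnit q := IsUnit.of_mul_eq_one p hqp
  have hpq : ∀ i, p ^ i * q ^ i = 1 := fun i => by rw [← mul_pow, mul_comm, hqp, one_pow]
  set Q := q ^ (s + 2) with hQ
  set x := p ^ (s + 1)
  have hQt : ∀ i, Q ^ (i * (t + 2)) = q ^ (i * (M + 2)) := fun i => by
    rw [hQ, ← pow_mul, ← hM]; congr 1; ring
  have hy : p ^ (M + 1) = 1 + δ * (-1) := by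
    have := hpq (M + 1)
    rw [hq] at this
    linear_combination (1 - δ) * this + p ^ (M + 1) * hδ
  set y := p ^ (M + 1)
  have hyq : y * q ^ (M + 1) = 1 := hpq _
  have hypow : y ^ (s + 1) = 1 + δ * (-(s + 1)) := by
    rw [hy, add_mul_pow_of_sq_eq_zero hδ]; push_cast; ring
  have hyQ : y ^ (s + 1) * Q ^ ((s + 1) * (t + 2)) = q ^ (s + 1) := by
    rw [hQt, show (s + 1) * (M + 2) = (M + 1) * (s + 1) + (s + 1) by ring,
      pow_add q ((M + 1) * (s + 1)), pow_mul q, ← mul_assoc, ← mul_pow, hyq, one_pow, one_mul]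
  -- For `j < r` the exponents `d (j + 1)` and `d (j + 1) - n` are not multiples of `n`, so the
  -- denominators `(q^d; q^d)_m` and `(q^(d-n); q^d)_m` with `m ≤ r` are units.
  have hcop : Nat.Coprime (M + 1) (s + 2) := by
    have h : Nat.Coprime (M + 1) ((s + 2) * (t + 2)) := by
      rw [hM]; exact (Nat.coprime_self_add_right (m := M + 1) (n := 1)).mpr (by simp)
    exact Nat.Coprime.coprime_mul_right_right h
  have hlt : t + 2 ≤ M := by nlinarith
  have hndvd : ∀ j, j < t + 2 → ¬ (M + 1) ∣ (s + 2) * (j + 1) := fun j hj hdvd => by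
    have := Nat.le_of_dvd (Nat.succ_pos j) (hcop.dvd_of_dvd_mul_left hdvd)
    omega
  have hunitQ : ∀ m, m ≤ t + 2 → IsUnit (qShiftedFactorial Q Q m) := fun m hm => by
    unfold qShiftedFactorial
    refine (IsUnit.prod_iff).mpr fun j hj => ?_
    rw [← pow_succ', hQ, ← pow_mul]
    exact hunit _ (hndvd j ((Finset.mem_range.mp hj).trans_le hm))
  have hunity : ∀ m, m ≤ t + 2 → IsUnit (qShiftedFactorial (y * Q) Q m) := fun m hm => by
    unfold qShiftedFactorial
    refine (IsUnit.prod_iff).mpr fun j hj => ?_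
    have hu := hunit _ (hndvd j ((Finset.mem_range.mp hj).trans_le hm))
    have hnil : IsNilpotent (δ * Q ^ (j + 1)) := ⟨2, by rw [mul_pow, hδ, zero_mul]⟩
    rw [show 1 - y * Q * Q ^ j = δ * Q ^ (j + 1) + (1 - q ^ ((s + 2) * (j + 1))) by
      rw [hy, hQ, ← pow_mul]; ring]
    exact hnil.isUnit_add_right_of_commute hu (Commute.all _ _)
  -- With `y = q^(-n)`, the shifts by `n` turn every numerator parameter into a denominator parameter
  -- times a power of `Q = q^d`, because `q^(n+1) = Q^r`.
  have hA : y * Q * Q ^ (t + 2) = q ^ (s + 3) := by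
    have := hQt 1
    rw [one_mul, one_mul] at this
    rw [this, hQ]
    linear_combination q ^ (s + 3) * hyq
  have hB1 : y * Q * Q ^ (t + 1) = q := by
    have := hQt 1
    rw [one_mul, one_mul] at this
    rw [mul_assoc, ← pow_succ', this]
    linear_combination q * hyq
  have hB0 : Q * Q ^ (t + 1) = q * (1 + δ * 1) := by
    have := hQt 1
    rw [one_mul, one_mul] at this
    rw [← pow_succ', this, mul_one, ← hq, ← pow_succ']
  have hC : y * Q * Q ^ t = x := by
    have h1 : y * Q * Q ^ t * Q = x * Q := by
      rw [mul_assoc, ← pow_succ, hB1, hQ, pow_succ, ← mul_assoc, hpq, one_mul]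
    exact (hqu.pow (s + 2)).mul_right_cancel h1
  have hcP : q * y ^ (s + 1) * Q ^ (s * (t + 2) + t + 1) = 1 := by
    have h1 : q * y ^ (s + 1) * Q ^ (s * (t + 2) + t + 1) * Q = 1 * Q := by
      rw [mul_assoc, ← pow_succ, show s * (t + 2) + t + 1 + 1 = (s + 1) * (t + 2) by ring,
        mul_assoc, hyQ, hQ, one_mul, ← pow_succ']
    exact (hqu.pow (s + 2)).mul_right_cancel h1
  have hcQ : x * y ^ (s + 1) * Q ^ ((s + 1) * (t + 2)) = 1 := by
    rw [mul_assoc, hyQ, hpq]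
  -- In `hP` the terminating parameter is `q^(1-(d-1)n)`, in place of `q`; in `hQ0` and `hQ1` it is
  -- `q^(1-d-(d-1)n)`, in place of `q^(1-d)`. The last two differ by the pair of parameters `q^(1+n)`
  -- over `q^d`, respectively `q` over `q^(d-n)`.
  have hP := sum_karlsson_minton_eq_zero Q (q * y ^ (s + 1)) (y * Q) (y * Q) _ M s (t + 2) t hcP
    (by nlinarith) (by omega) (hunity _ le_rfl) (hunity _ (by omega))
  have hQ0 := sum_karlsson_minton_eq_zero Q (x * y ^ (s + 1)) (y * Q) Q _ M s (t + 2) (t + 1) hcQ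
    (by nlinarith) (by nlinarith) (hunity _ le_rfl) (hunitQ _ (by omega))
  have hQ1 := sum_karlsson_minton_eq_zero Q (x * y ^ (s + 1)) (y * Q) (y * Q) _ M s (t + 2) (t + 1)
    hcQ (by nlinarith) (by nlinarith) (hunity _ le_rfl) (hunity _ (by omega))
  rw [hA, hC] at hP
  rw [hA, hB0] at hQ0
  rw [hA, hB1] at hQ1
  -- To first order, `hP` moves `q` and `1 / q^d` by `-(d - 1) δ` each, and the difference of `hQ0`
  -- and `hQ1` is the effect of moving both by `δ`; so `hP + (d - 1) (hQ0 - hQ1)` is undeformed.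
  have hcomb : ∀ a b c : R, a = 0 → b = 0 → c = 0 → a + (s + 1) * (b - c) = 0 := by
    rintro _ _ _ rfl rfl rfl; ring
  refine Eq.trans ?_ (hcomb _ _ _ hP hQ0 hQ1)
  rw [← Finset.sum_sub_distrib, Finset.mul_sum, ← Finset.sum_add_distrib]
  refine Finset.sum_congr rfl fun k _ => ?_
  obtain ⟨B', hB'⟩ := exists_qShiftedFactorial_first_order hδ q Q k
  obtain ⟨C', hC'⟩ := exists_qShiftedFactorial_first_order hδ x Q k
  obtain ⟨D', hD'⟩ := exists_qShiftedFactorial_first_order hδ (Q ^ (k + 1)) Q (M - k)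
  rw [hypow, hB', hB', hC', show y * Q * Q ^ k = Q ^ (k + 1) * (1 + δ * (-1)) by rw [hy]; ring,
    hD', ← pow_succ']
  generalize qShiftedFactorial (q ^ (s + 3)) Q k = A
  generalize qShiftedFactorial q Q k = B
  generalize qShiftedFactorial x Q k = C
  generalize qShiftedFactorial (Q ^ (k + 1)) Q (M - k) = D
  have hDs := add_mul_pow_of_sq_eq_zero hδ D (-D') s
  have hDs1 := add_mul_pow_of_sq_eq_zero hδ D (-D') (s + 1)
  rw [Nat.add_sub_cancel] at hDs1
  push_cast at hDs1
  generalize (s : R) * D ^ (s - 1) = E at hDs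
  rw [show δ * -1 * D' = δ * -D' by ring, mul_pow, hDs]
  have hP' : (B + δ * -(s + 1) * B') * D * Q ^ k *
      (A ^ s * (D ^ s + E * (δ * -D')) * (C * (D + δ * -D'))) =
      (B + δ * -(s + 1) * B') * D * Q ^ k * A ^ s * C *
        (D ^ (s + 1) + (s + 1) * D ^ s * (δ * -D')) := by
    rw [← hDs1, pow_succ, hDs]; ring
  rw [hP']
  linear_combination (-(A ^ s * Q ^ k * D) * (C * (s + 1) ^ 2 * B' * D ^ s * D' +
    (s + 1) * (B' * D + B * D') * (-C * E * D' - (s + 1) * C' * D ^ s +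
      δ * (s + 1) * C' * E * D'))) * hδ

end FirstOrder

/-! ### The summands as polynomials with integer coefficients -/

section QIntegers

/-- The product `[a] [a + d] ⋯ [a + d (k - 1)]` of `q`-integers. -/
noncomputable def qIntegerProd (a d k : ℕ) : ℤ[X] :=
  ∏ j ∈ Finset.range k, qInteger (a + d * j)

/-- The polynomial `q^(d k) (q^(1-d); q^d)_k / (1 - q)^k`. The factor `q^(d k)` clears the negative
power of `q` in `1 - q^(1-d) = -q^(1-d) (1 - q^(d-1))`; the other factors have positive exponents. -/
noncomputable def lowerFactor (d : ℕ) : ℕ → ℤ[X]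
  | 0 => 1
  | k + 1 => -(X ^ (d * k + 1) * qInteger (d - 1) * qIntegerProd 1 d k)

/-- The `k`-th summand of `normalizedSum d n`, with the prefactor distributed over the sum: each
copy of `(q^d; q^d)_(n-1)` absorbs one `(q^d; q^d)_k` in the denominator, and the remaining `d (n - 1)` factors
of the form `1 - q^i` are divided by `1 - q`. -/
noncomputable def normalizedTerm (d n k : ℕ) : ℤ[X] :=
  qIntegerProd (d + 1) d k ^ (d - 2) * (qIntegerProd 1 d k * lowerFactor d k) *
    qIntegerProd (d * (k + 1)) d (n - 1 - k) ^ d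

variable {R : Type*} [CommRing R] (φ : ℤ[X] →+* R)

theorem map_qInteger_mul (j : ℕ) : φ (qInteger j) * (1 - φ X) = 1 - φ X ^ j := by
  simp only [qInteger, map_sum, map_pow]
  exact geom_sum_mul_neg _ _

theorem map_qIntegerProd_mul (a d k : ℕ) :
    φ (qIntegerProd a d k) * (1 - φ X) ^ k = qShiftedFactorial (φ X ^ a) (φ X ^ d) k := by
  rw [qIntegerProd, map_prod, ← Finset.card_range k, ← Finset.prod_const, Finset.card_range,
    ← Finset.prod_mul_distrib, qShiftedFactorial]
  refine Finset.prod_congr rfl fun j _ => ?_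
  rw [map_qInteger_mul, pow_add, pow_mul]

/-- The element `x` plays the role of `q^(1-d)` in a ring where `q` need not be invertible a priori. -/
theorem map_lowerFactor_mul {d : ℕ} (hd : 1 ≤ d) {x : R} (hx : x * φ X ^ (d - 1) = 1) (k : ℕ) :
    φ (lowerFactor d k) * (1 - φ X) ^ k =
      qShiftedFactorial x (φ X ^ d) k * (φ X ^ d) ^ k := by
  obtain ⟨d, rfl⟩ := Nat.exists_eq_add_of_le' hd
  rw [Nat.add_sub_cancel] at hx
  cases k with
  | zero => simp [lowerFactor, qShiftedFactorial]
  | succ k =>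
    have h1 := map_qInteger_mul φ d
    have h2 := map_qIntegerProd_mul φ 1 (d + 1) k
    have h3 : x * φ X ^ (d + 1) = φ X := by rw [pow_succ, ← mul_assoc, hx, one_mul]
    rw [pow_one] at h2
    rw [qShiftedFactorial_succ', h3, ← h2]
    simp only [lowerFactor, Nat.add_sub_cancel, map_neg, map_mul, map_pow]
    have h4 : (1 - x) * φ X ^ (d + 1) = -(φ X * (1 - φ X ^ d)) := by
      linear_combination -h3
    have h5 : φ X ^ ((d + 1) * k + 1) = (φ X ^ (d + 1)) ^ k * φ X := by
      rw [pow_succ, pow_mul]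
    rw [h5, pow_succ (φ X ^ (d + 1)) k]
    linear_combination (-(φ (qIntegerProd 1 (d + 1) k)) * (1 - φ X) ^ k * (φ X ^ (d + 1)) ^ k) *
      (φ X * h1 + h4)

theorem map_normalizedTerm_mul {d n k : ℕ} (hd : 2 ≤ d) (hk : k < n) {x : R}
    (hx : x * φ X ^ (d - 1) = 1) :
    φ (normalizedTerm d n k) * (1 - φ X) ^ (d * n - d) =
      qShiftedFactorial (φ X ^ (d + 1)) (φ X ^ d) k ^ (d - 2) *
        (qShiftedFactorial (φ X) (φ X ^ d) k * qShiftedFactorial x (φ X ^ d) k) *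
        (φ X ^ d) ^ k *
        qShiftedFactorial ((φ X ^ d) ^ (k + 1)) (φ X ^ d) (n - 1 - k) ^ d := by
  have hB := map_qIntegerProd_mul φ 1 d k
  rw [pow_one] at hB
  have hexp : d * n - d = k * (d - 2) + (k + k) + (n - 1 - k) * d := by
    obtain ⟨s, rfl⟩ := Nat.exists_eq_add_of_le' hd
    obtain ⟨l, rfl⟩ := Nat.exists_eq_add_of_lt hk
    rw [show k + l + 1 - 1 - k = l by omega, Nat.add_sub_cancel]
    refine Nat.sub_eq_of_eq_add ?_
    ring
  have hC := map_lowerFactor_mul φ (by omega : 1 ≤ d) hx k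
  rw [← pow_mul (φ X) d (k + 1), ← map_qIntegerProd_mul φ (d + 1),
    ← map_qIntegerProd_mul φ (d * (k + 1)), ← hB, hexp, mul_assoc _ _ (_ ^ k),
    mul_assoc _ _ ((φ X ^ d) ^ k), ← hC]
  simp only [normalizedTerm, map_mul, map_pow, mul_pow, pow_add, pow_mul]
  ring

end QIntegers

/-! ### Divisibility by the square of a `q`-integer -/

section Divisibility

theorem qInteger_eq_prod_cyclotomic {n : ℕ} (hn : 0 < n) :
    qInteger n = ∏ m ∈ n.divisors.erase 1, cyclotomic m ℤ :=
  (prod_cyclotomic_eq_geom_sum hn ℤ).symm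

theorem qInteger_monic {n : ℕ} (hn : 0 < n) : (qInteger n).Monic := by
  rw [qInteger_eq_prod_cyclotomic hn]
  exact monic_prod_of_monic _ _ fun m _ => cyclotomic.monic m ℤ

theorem cyclotomic_dvd_qInteger {m j : ℕ} (hm : m ≠ 1) (hj : m ∣ j) :
    cyclotomic m ℤ ∣ qInteger j := by
  rcases Nat.eq_zero_or_pos j with rfl | hpos
  · simp [qInteger]
  · rw [qInteger_eq_prod_cyclotomic hpos]
    exact Finset.dvd_prod_of_mem _ (Finset.mem_erase.mpr ⟨hm, Nat.mem_divisors.mpr ⟨hj, hpos.ne'⟩⟩)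

theorem cyclotomic_dvd_qIntegerProd {m a d k j : ℕ} (hm : m ≠ 1) (hj : j < k)
    (hdvd : m ∣ a + d * j) : cyclotomic m ℤ ∣ qIntegerProd a d k :=
  (cyclotomic_dvd_qInteger hm hdvd).trans (Finset.dvd_prod_of_mem _ (Finset.mem_range.mpr hj))

theorem exists_lt_dvd_one_add_mul {m d : ℕ} (hm : 0 < m) (h : Nat.Coprime d m) :
    ∃ j < m, m ∣ 1 + d * j := by
  have : NeZero m := ⟨hm.ne'⟩
  refine ⟨(-(ZMod.unitOfCoprime d h)⁻¹ : (ZMod m)ˣ).val.val, ZMod.val_lt _, ?_⟩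
  rw [← ZMod.natCast_eq_zero_iff]
  push_cast
  rw [ZMod.natCast_val, ZMod.cast_id', id, ← ZMod.coe_unitOfCoprime d h, mul_neg,
    Units.mul_inv, add_neg_cancel]

/-- For a proper divisor `m > 1` of `n`, each summand is divisible by the square of the `m`-th cyclotomic
polynomial: both `(q; q^d)_k` and `(q^(1-d); q^d)_k`, multiplied by `(q^d; q^d)_(n-1) / (q^d; q^d)_k`,
have a factor `1 - q^i` with `m ∣ i`. -/
theorem cyclotomic_sq_dvd_normalizedTerm_of_lt {d n m k : ℕ} (hd : 2 ≤ d)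
    (hcop : Nat.Coprime d n) (hm1 : m ≠ 1) (hmn : m ∣ n) (hlt : m < n) (hk : k < n) :
    cyclotomic m ℤ ^ 2 ∣ normalizedTerm d n k := by
  have hm0 : 0 < m := Nat.pos_of_dvd_of_pos hmn (by omega)
  obtain ⟨i, hi⟩ := hmn
  have hi2 : 2 ≤ i := by
    by_contra hcon
    have : i ≤ 1 := by omega
    have := Nat.mul_le_mul_left m this
    omega
  have hmm : m + m ≤ n := by nlinarith
  obtain ⟨s, rfl⟩ := Nat.exists_eq_add_of_le' hd
  have key : cyclotomic m ℤ ∣ qIntegerProd 1 (s + 2) k *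
        qIntegerProd ((s + 2) * (k + 1)) (s + 2) (n - 1 - k) ∧
      cyclotomic m ℤ ∣ lowerFactor (s + 2) k *
        qIntegerProd ((s + 2) * (k + 1)) (s + 2) (n - 1 - k) := by
    -- For `k < n - m` the complementary product contains `[d (n - m)]`. Otherwise `k ≥ n - m ≥ m`, and
    -- the first `m` factors of each numerator run through all residues modulo `m`.
    by_cases hkm : k < n - m
    · have h : cyclotomic m ℤ ∣ qIntegerProd ((s + 2) * (k + 1)) (s + 2) (n - 1 - k) := by
        refine cyclotomic_dvd_qIntegerProd (j := n - m - 1 - k) hm1 (by omega) ?_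
        rw [← mul_add, show k + 1 + (n - m - 1 - k) = n - m by omega]
        exact ((Nat.dvd_sub ⟨i, hi⟩ dvd_rfl)).mul_left _
      exact ⟨h.mul_left _, h.mul_left _⟩
    · obtain ⟨j, hj, hjdvd⟩ := exists_lt_dvd_one_add_mul hm0
        (Nat.Coprime.coprime_dvd_right ⟨i, hi⟩ hcop)
      refine ⟨(cyclotomic_dvd_qIntegerProd (j := j) hm1 (by omega) hjdvd).mul_right _, ?_⟩
      obtain ⟨k, rfl⟩ : ∃ k', k = k' + 1 := ⟨k - 1, by omega⟩
      refine Dvd.dvd.mul_right ?_ _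
      rw [lowerFactor, dvd_neg]
      rcases Nat.lt_or_ge j k with hjk | hjk
      · exact (cyclotomic_dvd_qIntegerProd hm1 hjk hjdvd).mul_left _
      · -- Only `j = m - 1` is left; then `m ∣ d m - (1 + d j) = d - 1`.
        have hjm : j + 1 = m := by omega
        refine Dvd.dvd.mul_right (Dvd.dvd.mul_left (cyclotomic_dvd_qInteger hm1 ?_) _) _
        have h : (s + 2) * m = (1 + (s + 2) * j) + (s + 2 - 1) := by
          rw [← hjm]; simp only [show s + 2 - 1 = s + 1 by omega]; ring
        exact (Nat.dvd_add_right hjdvd).mp (h ▸ dvd_mul_left m _)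
  obtain ⟨g₁, hg₁⟩ := key.1
  obtain ⟨g₂, hg₂⟩ := key.2
  refine ⟨qIntegerProd (s + 2 + 1) (s + 2) k ^ s *
    qIntegerProd ((s + 2) * (k + 1)) (s + 2) (n - 1 - k) ^ s * g₁ * g₂, ?_⟩
  rw [normalizedTerm, Nat.add_sub_cancel]
  linear_combination (qIntegerProd (s + 2 + 1) (s + 2) k ^ s *
    qIntegerProd ((s + 2) * (k + 1)) (s + 2) (n - 1 - k) ^ s) *
    (hg₁ * (lowerFactor (s + 2) k * qIntegerProd ((s + 2) * (k + 1)) (s + 2) (n - 1 - k)) +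
      cyclotomic m ℤ * g₁ * hg₂)

theorem isCoprime_one_sub_X_pow_cyclotomic {n j : ℕ} (h : ¬ n ∣ j) :
    IsCoprime (1 - X ^ j : ℚ[X]) (cyclotomic n ℚ) := by
  have hj : 0 < j := Nat.pos_of_ne_zero (by rintro rfl; exact h (dvd_zero n))
  rw [← neg_sub, IsCoprime.neg_left_iff, ← prod_cyclotomic_eq_X_pow_sub_one hj]
  refine IsCoprime.prod_left fun i hi => cyclotomic.isCoprime_rat ?_
  rintro rfl
  exact h (Nat.dvd_of_mem_divisors hi)

/-- Divisibility by the square of the `n`-th cyclotomic polynomial `Φ`, tested in `ℚ[q] / (Φ ^ 2)`: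
there `(q^n - 1)^2 = 0`, and `1 - q^j` is a unit unless `n ∣ j`. -/
theorem cyclotomic_sq_dvd_sum_normalizedTerm {d n r : ℕ} (hd : 2 ≤ d) (hr : 2 ≤ r)
    (hdr : d * r = n + 1) :
    (cyclotomic n ℚ) ^ 2 ∣
      (∑ k ∈ Finset.range n, normalizedTerm d n k).map (Int.castRingHom ℚ) := by
  obtain ⟨s, rfl⟩ := Nat.exists_eq_add_of_le' hd
  obtain ⟨t, rfl⟩ := Nat.exists_eq_add_of_le' hr
  obtain ⟨M, rfl⟩ : ∃ M, n = M + 1 := ⟨n - 1, by have := Nat.mul_le_mul hd hr; omega⟩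
  have hM0 : 0 < M := by have := Nat.mul_le_mul hd hr; omega
  set Φ := cyclotomic (M + 1) ℚ
  let π : ℚ[X] →+* ℚ[X] ⧸ Ideal.span {Φ ^ 2} := Ideal.Quotient.mk _
  let φ : ℤ[X] →+* ℚ[X] ⧸ Ideal.span {Φ ^ 2} := π.comp (mapRingHom (Int.castRingHom ℚ))
  have hπ : ∀ g, π g = 0 ↔ Φ ^ 2 ∣ g := fun g => by
    rw [Ideal.Quotient.eq_zero_iff_mem, Ideal.mem_span_singleton]
  have hφX : φ X = π X := by simp [φ]
  have hunit : ∀ j, ¬ (M + 1) ∣ j → IsUnit (1 - φ X ^ j) := fun j hj => by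
    obtain ⟨a, b, hab⟩ := (isCoprime_one_sub_X_pow_cyclotomic hj).pow_right (n := 2)
    refine IsUnit.of_mul_eq_one (π a) ?_
    rw [hφX, ← map_one π, ← map_pow, ← map_sub, ← map_mul, ← sub_eq_zero, ← map_sub, hπ]
    exact ⟨-b, by linear_combination hab⟩
  obtain ⟨δ, hδ⟩ : ∃ δ, φ X ^ (M + 1) = 1 + δ := ⟨φ X ^ (M + 1) - 1, by ring⟩
  have hδ2 : δ ^ 2 = 0 := by
    rw [← add_sub_cancel_left 1 δ, ← hδ, hφX, ← map_one π, ← map_pow, ← map_sub, ← map_pow, hπ]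
    exact pow_dvd_pow_of_dvd (cyclotomic.dvd_X_pow_sub_one _ _) 2
  set p := φ X ^ M * (1 - δ) with hp
  have hqp : φ X * p = 1 := by
    rw [hp, ← mul_assoc, ← pow_succ', hδ]; linear_combination -hδ2
  have hsum := sum_eq_zero_of_pow_eq_one_add hqp hdr hδ hδ2 hunit
  have hx : p ^ (s + 1) * φ X ^ (s + 2 - 1) = 1 := by
    rw [show s + 2 - 1 = s + 1 by omega, ← mul_pow, mul_comm, hqp, one_pow]
  rw [← hπ]
  change φ _ = 0
  have hone : IsUnit (1 - φ X) := by
    have := hunit 1 (by rw [Nat.dvd_one]; omega)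
    rwa [pow_one] at this
  refine (hone.pow ((s + 2) * (M + 1) - (s + 2))).mul_left_eq_zero.mp ?_
  rw [map_sum, Finset.sum_mul, ← hsum]
  refine Finset.sum_congr rfl fun k hk => ?_
  rw [map_normalizedTerm_mul φ hd (Finset.mem_range.mp hk) hx]
  simp only [Nat.add_sub_cancel]

theorem qInteger_sq_dvd_sum_normalizedTerm {d n r : ℕ} (hd : 2 ≤ d) (hr : 2 ≤ r)
    (hdr : d * r = n + 1) :
    qInteger n ^ 2 ∣ ∑ k ∈ Finset.range n, normalizedTerm d n k := by
  have hn : 0 < n := by have := Nat.mul_le_mul hd hr; omega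
  have hcop : Nat.Coprime d n := by
    have h : Nat.Coprime (d * r) n := by
      rw [hdr]; exact (Nat.coprime_self_add_left (m := n) (n := 1)).mpr (by simp)
    exact Nat.Coprime.coprime_mul_right h
  refine (map_dvd_map (Int.castRingHom ℚ) Int.cast_injective ((qInteger_monic hn).pow 2)).mp ?_
  rw [qInteger_eq_prod_cyclotomic hn, ← Finset.prod_pow, Polynomial.map_prod]
  simp only [Polynomial.map_pow, map_cyclotomic]
  refine Finset.prod_dvd_of_coprime (fun a _ b _ hab => (cyclotomic.isCoprime_rat hab).pow) ?_
  intro m hm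
  obtain ⟨hm1, hm⟩ := Finset.mem_erase.mp hm
  have hmn := Nat.dvd_of_mem_divisors hm
  rcases (Nat.le_of_dvd hn hmn).eq_or_lt with rfl | hlt
  · exact cyclotomic_sq_dvd_sum_normalizedTerm hd hr hdr
  · rw [← map_cyclotomic_int, ← Polynomial.map_pow]
    refine Polynomial.map_dvd _ (Finset.dvd_sum fun k hk => ?_)
    exact cyclotomic_sq_dvd_normalizedTerm_of_lt hd hcop hm1 hmn hlt (Finset.mem_range.mp hk)

end Divisibility

/-! ### Comparison with the rational function, and its value at one -/

section Specialization

theorem normalizedSum_eq_algebraMap {d n : ℕ} (hd : 2 ≤ d) :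
    normalizedSum d n =
      algebraMap ℤ[X] (RatFunc ℤ) (∑ k ∈ Finset.range n, normalizedTerm d n k) := by
  have hX0 : (RatFunc.X : RatFunc ℤ) ≠ 0 := by
    rw [← RatFunc.algebraMap_X]
    exact (map_ne_zero_iff _ (RatFunc.algebraMap_injective ℤ)).mpr X_ne_zero
  have hpow : ∀ j, 0 < j → (1 - RatFunc.X ^ j : RatFunc ℤ) ≠ 0 := by
    intro j hj h
    have h' : algebraMap ℤ[X] (RatFunc ℤ) (X ^ j - 1) = 0 := by
      rw [map_sub, map_pow, map_one, RatFunc.algebraMap_X, ← neg_eq_zero, neg_sub, h]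
    exact X_pow_sub_C_ne_zero hj (1 : ℤ)
      (by simpa using (map_eq_zero_iff _ (RatFunc.algebraMap_injective ℤ)).mp h')
  have hx : (RatFunc.X : RatFunc ℤ) ^ (1 - (d : ℤ)) *
      algebraMap ℤ[X] (RatFunc ℤ) X ^ (d - 1) = 1 := by
    rw [RatFunc.algebraMap_X, ← zpow_natCast, ← zpow_add₀ hX0, Nat.cast_sub (by omega)]
    simp
  simp only [normalizedSum]
  rw [map_sum, Finset.mul_sum]
  refine Finset.sum_congr rfl fun k hk => ?_
  have hk := Finset.mem_range.mp hk
  have hterm := map_normalizedTerm_mul (algebraMap ℤ[X] (RatFunc ℤ)) hd hk hx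
  rw [RatFunc.algebraMap_X] at hterm
  have hone : (1 - RatFunc.X : RatFunc ℤ) ^ (d * n - d) ≠ 0 := by
    have := hpow 1 one_pos
    rw [pow_one] at this
    exact pow_ne_zero _ this
  rw [← mul_left_inj' hone, hterm]
  have hsplit := qShiftedFactorial_add (RatFunc.X ^ d : RatFunc ℤ) (RatFunc.X ^ d) k (n - 1 - k)
  rw [show k + (n - 1 - k) = n - 1 by omega, ← pow_succ'] at hsplit
  have hden : qShiftedFactorial (RatFunc.X ^ d : RatFunc ℤ) (RatFunc.X ^ d) k ≠ 0 := by
    rw [qShiftedFactorial, Finset.prod_ne_zero_iff]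
    intro j _
    rw [← pow_succ', ← pow_mul]
    exact hpow _ (Nat.mul_pos (by omega) (Nat.succ_pos j))
  rw [hsplit, mul_pow, pow_mul RatFunc.X d k]
  field_simp

theorem ascPochhammer_div_mul_pow {d : ℕ} (hd : d ≠ 0) (x : ℚ) (k : ℕ) :
    (ascPochhammer ℚ k).eval (x / d) * (d : ℚ) ^ k =
      ∏ j ∈ Finset.range k, (x + d * j) := by
  have hd' : (d : ℚ) ≠ 0 := Nat.cast_ne_zero.mpr hd
  induction k with
  | zero => simp
  | succ k ih =>
    rw [ascPochhammer_succ_eval, Finset.prod_range_succ, ← ih, pow_succ]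
    field_simp

theorem eval_one_qInteger (j : ℕ) : (qInteger j).eval 1 = j := by
  simp [qInteger, eval_finsetSum]

theorem cast_eval_one_qIntegerProd (a d k : ℕ) :
    (((qIntegerProd a d k).eval 1 : ℤ) : ℚ) = ∏ j ∈ Finset.range k, ((a : ℚ) + d * j) := by
  simp [qIntegerProd, eval_prod, eval_one_qInteger]

theorem cast_eval_one_lowerFactor {d : ℕ} (hd : 1 ≤ d) (k : ℕ) :
    (((lowerFactor d k).eval 1 : ℤ) : ℚ) = ∏ j ∈ Finset.range k, (1 - (d : ℚ) + d * j) := by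
  cases k with
  | zero => simp [lowerFactor]
  | succ k =>
    rw [Finset.prod_range_succ', lowerFactor]
    simp only [eval_neg, eval_mul, eval_pow, eval_X, one_pow, one_mul, eval_one_qInteger,
      Int.cast_neg, Int.cast_mul, cast_eval_one_qIntegerProd, Nat.cast_sub hd]
    rw [Finset.prod_congr rfl fun j _ => show 1 - (d : ℚ) + d * ((j + 1 : ℕ) : ℚ) =
      ((1 : ℕ) : ℚ) + d * j by push_cast; ring]
    push_cast
    ring

theorem cast_eval_one_normalizedTerm {d n k : ℕ} (hd : 2 ≤ d) (hk : k < n) :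
    (((normalizedTerm d n k).eval 1 : ℤ) : ℚ) =
      (Nat.factorial (n - 1) : ℚ) ^ d * (d : ℚ) ^ (d * n - d) *
        ((ascPochhammer ℚ k).eval (((d : ℚ) + 1) / d) ^ (d - 2) *
            (ascPochhammer ℚ k).eval (1 / (d : ℚ)) *
            (ascPochhammer ℚ k).eval ((1 - (d : ℚ)) / d) /
          (ascPochhammer ℚ k).eval (1 : ℚ) ^ d) := by
  obtain ⟨s, rfl⟩ := Nat.exists_eq_add_of_le' hd
  obtain ⟨l, rfl⟩ := Nat.exists_eq_add_of_lt hk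
  have hd0 : s + 2 ≠ 0 := by omega
  have hfac : ∀ m : ℕ, (Nat.factorial m : ℚ) * ((s + 2 : ℕ) : ℚ) ^ m =
      ∏ j ∈ Finset.range m, (((s + 2 : ℕ) : ℚ) + (s + 2 : ℕ) * j) := by
    intro m
    rw [← ascPochhammer_div_mul_pow hd0, div_self (Nat.cast_ne_zero.mpr hd0),
      ascPochhammer_eval_one]
  have hsplit : (Nat.factorial (k + l) : ℚ) * ((s + 2 : ℕ) : ℚ) ^ (k + l) =
      (Nat.factorial k * ((s + 2 : ℕ) : ℚ) ^ k) *
        ∏ j ∈ Finset.range l, ((((s + 2) * (k + 1) : ℕ) : ℚ) + (s + 2 : ℕ) * j) := by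
    rw [hfac, hfac, Finset.prod_range_add]
    congr 1
    refine Finset.prod_congr rfl fun j _ => ?_
    push_cast
    ring
  have hk0 : (Nat.factorial k : ℚ) ≠ 0 := Nat.cast_ne_zero.mpr (Nat.factorial_ne_zero k)
  simp only [normalizedTerm, eval_mul, eval_pow, Int.cast_mul, Int.cast_pow,
    cast_eval_one_qIntegerProd, cast_eval_one_lowerFactor (by omega : 1 ≤ s + 2),
    Nat.add_sub_cancel, show k + l - k = l by omega, ascPochhammer_eval_one]
  rw [show (s + 2) * (k + l + 1) - (s + 2) = (k + l) * (s + 2) by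
      refine Nat.sub_eq_of_eq_add ?_; ring,
    pow_mul, ← mul_pow, hsplit]
  have hA := ascPochhammer_div_mul_pow hd0 (((s + 2 : ℕ) : ℚ) + 1) k
  have hB := ascPochhammer_div_mul_pow hd0 1 k
  have hC := ascPochhammer_div_mul_pow hd0 (1 - ((s + 2 : ℕ) : ℚ)) k
  rw [← hC, Nat.cast_add (s + 2) 1, Nat.cast_one, ← hA, ← hB]
  field_simp
  ring

end Specialization

/-- The first part is the congruence modulo `[n] ^ 2`: the left-hand side is a polynomial in `q` with
integer coefficients, and it is divisible by `[n] ^ 2` in `ℤ[q]`. The second part is the integrality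
assertion obtained for `q → 1`; the value of `ascPochhammer ℚ k` at `x` is `x (x+1) ⋯ (x+k-1)`. -/
theorem theorem1p3 (d n : ℕ) (hd : 2 ≤ d) (hmod : (n : ℤ) ≡ -1 [ZMOD (d : ℤ)])
    (hn : 2 * (d : ℤ) - 1 ≤ (n : ℤ)) :
    (∃ F : ℤ[X], normalizedSum d n = algebraMap ℤ[X] (RatFunc ℤ) F ∧ qInteger n ^ 2 ∣ F) ∧
    (∃ z : ℤ,
      ((Nat.factorial (n - 1) : ℚ) ^ d * (d : ℚ) ^ (d * n - d) / (n : ℚ) ^ 2) *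
        ∑ k ∈ Finset.range n,
          (ascPochhammer ℚ k).eval (((d : ℚ) + 1) / d) ^ (d - 2) *
              (ascPochhammer ℚ k).eval (1 / (d : ℚ)) *
              (ascPochhammer ℚ k).eval ((1 - (d : ℚ)) / d) /
            (ascPochhammer ℚ k).eval (1 : ℚ) ^ d
        = (z : ℚ)) := by
  obtain ⟨r, hdr⟩ : d ∣ n + 1 := by
    have h := hmod.symm.dvd
    rw [sub_neg_eq_add] at h
    exact_mod_cast h
  have hr : 2 ≤ r := by
    by_contra hcon
    have := Nat.mul_le_mul_left d (show r ≤ 1 by omega)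
    omega
  have hdvd := qInteger_sq_dvd_sum_normalizedTerm hd hr hdr.symm
  refine ⟨⟨_, normalizedSum_eq_algebraMap hd, hdvd⟩, ?_⟩
  obtain ⟨G, hG⟩ := hdvd
  refine ⟨G.eval 1, ?_⟩
  have hn0 : (n : ℚ) ≠ 0 := Nat.cast_ne_zero.mpr (by omega)
  have heval := congrArg (fun g : ℤ[X] => ((g.eval 1 : ℤ) : ℚ)) hG
  simp only [eval_finsetSum, eval_mul, eval_pow, eval_one_qInteger, Int.cast_sum, Int.cast_mul,
    Int.cast_pow, Int.cast_natCast] at heval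
  rw [Finset.sum_congr rfl fun k hk => cast_eval_one_normalizedTerm hd (Finset.mem_range.mp hk),
    ← Finset.mul_sum] at heval
  rw [div_mul_eq_mul_div, heval]
  field_simp
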